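/- Multi-hop amplify-and-forward (AF) user cooperation. Consider users $1,\dots,K$ and a destination $d$. User $k$ is helped by $L-1$ other users ($1\le L\le K$), listed as $\pi(2),\dots,\pi(L)$ with $\pi$ injective and $\pi(1)=k$; write $\mathcal C_k=\{\pi(2),\dots,\pi(L)\}$. The fading gain from node $j$ to node $m\ne j$ is $H_{m,j}=A_{m,j}/d_{m,j}^{\gamma/2}$ with distances $d_{m,j}>0$, path-loss exponent $\gamma$, and independent circularly symmetric complex Gaussian $A_{m,j}$ of mean $0$ and variance $1$. User $j$ has power $P_j=\lambda_jP$ with fixed $\lambda_j>0$, $\lambda_k=1$ (for equal powers, all $\lambda_j=1$). The transmission is divided into $L$ equal slots. User $k$ sends independent Gaussian symbols $X_1,\dots,X_L$ of power $P$, one per slot, and in slot $l\ge2$ user $j=\pi(l)$ also sends $c_j(H_{j,k}X_1+Z_j)$, the scaled version of what it received in slot $1$, where $$c_j=\Big(\frac{\beta P_j}{|H_{j,k}|^2P+1}\Big)^{1/2},\qquad 1\le\beta\le\max(2,L)$$ (this allows both $\beta=2$ and the normalisation $\beta=L$ for slots of length $1/L$). All noises are independent with unit variance. After the output of slot $l\geq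 2$ is divided by $c_{s,j}=(1+|c_jH_{d,j}|^2)^{1/2}$, so that all noise variances are $1$, the channel is $\underline Y=\mathbf H\underline X+\underline Z$, where the only nonzero entries of the $L\times L$ matrix $\mathbf H$ are $\mathbf H_{11}=H_{d,k}$ and, for $l\ge2$ and $j=\pi(l)$, $\mathbf H_{l1}=c_jH_{d,j}H_{j,k}/c_{s,j}$ and $\mathbf H_{ll}=H_{d,k}/c_{s,j}$. For a fixed rate $R>0$ let $$P_o(P)=\Pr\big(\log_2\det(I+P\,\mathbf H\mathbf H^\dagger)<LR\big),\qquad P_{o,L\times1}(P)=\Pr\Big(\log_2\Big(1+\sum_{l=1}^{L}P_{\pi(l)}|H_{d,\pi(l)}|^2\Big)<R\Big),$$ the second being the outage probability of the distributed $L\times1$ MIMO channel. Then: 1. $P_o(P)\ge P_{o,L\times1}(P)$ for every $P>0$, and, as $P\to\infty$, $$P_{o,L\times1}(P)=\frac{(2^{R}-1)^{L}}{L!\,P^{L}}\prod_{l=1}^{L}\frac{d_{d,\pi(l)}^{\gamma}}{\lambda_{\pi(l)}}+O(P^{-L-1}).$$ 2. For all sufficiently large $P$, $$P_o(P)\le\frac{(2^{LR}-1)^{L}\,d_{d,k}^{\gamma}\prod_{j\in\mathcal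 C_k}\big(d_{d,j}^{\gamma}/\lambda_j+d_{j,k}^{\gamma}\big)}{L!\,P^{L}}.$$ 3. The scheme achieves diversity order $L$: $\displaystyle\lim_{P\to\infty}\frac{-\log P_o(P)}{\log P}=L$. -/

import Mathlib

open MeasureTheory ProbabilityTheory Filter Topology Asymptotics

noncomputable section

/-- The law of a proper (circularly symmetric) complex Gaussian variable with mean zero and unit
variance: independent real and imaginary parts, each `N(0, 1/2)`. -/
def stdComplexGaussian : Measure ℂ :=
  ((gaussianReal 0 (1 / 2)).prod (gaussianReal 0 (1 / 2))).map (fun p : ℝ × ℝ => (⟨p.1, p.2⟩ : ℂ))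

/-- Ordered pairs (receiver, transmitter) of distinct nodes in a network with users `Fin K` and one
destination. A receiver `none` is the destination, a receiver `some j` is user `j`. -/
abbrev Link (K : ℕ) : Type := {p : Option (Fin K) × Fin K // p.1 ≠ some p.2}

/-- The fading gain `H m j = A m j / d_{m,j}^{γ/2}` from user `j` to the receiver `m`. -/
def fadingGain {K : ℕ} (d : Option (Fin K) → Fin K → ℝ) (γ : ℝ) (a : Option (Fin K) → Fin K → ℂ)
    (m : Option (Fin K)) (j : Fin K) : ℂ :=
  a m j / (((d m j) ^ (γ / 2) : ℝ) : ℂ)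

/-- The amplification coefficient `c_j = √(β P_j / (|H_{j,k}|² P_k + 1))` of a cooperating user,
where `h = H_{j,k}` and `β` is the factor by which the power is raised while the user transmits. -/
def ampCoeff (β Pj Pk : ℝ) (h : ℂ) : ℝ :=
  Real.sqrt (β * Pj / (‖h‖ ^ 2 * Pk + 1))

/-- The standard deviation `c_s = √(1 + |c_j H_{d,j}|²)` of the noise
`Z'_d = c_j H_{d,j} Z_j + Z_d` seen by the destination in the slot in which user `j` forwards. -/
def noiseScale (c : ℝ) (g : ℂ) : ℝ :=
  Real.sqrt (1 + ‖(c : ℂ) * g‖ ^ 2)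

/-- The channel matrix of the multi-hop amplify-and-forward scheme with `n + 1` equal slots.
The source is user `π 0`; in slot `l.succ` user `π l.succ` forwards what it received in slot `0`,
while the source sends a fresh symbol. Rows are slots at the destination, scaled to unit noise
variance; columns are the symbols sent by the source. User `j` has power `lam j * P`.
Slot `0`:       `Y 0 = H_{d,k} X 0 + Z 0`.
Slot `l.succ`:  `Y l.succ = (H_{d,k} X l.succ + c H_{d,j} H_{j,k} X 0 + Z') / c_s`. -/
def afMatrix {K n : ℕ} (π : Fin (n + 1) → Fin K) (H : Option (Fin K) → Fin K → ℂ)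
    (β : ℝ) (lam : Fin K → ℝ) (P : ℝ) : Matrix (Fin (n + 1)) (Fin (n + 1)) ℂ :=
  Matrix.of fun l i =>
    Fin.cases
      (if i = 0 then H none (π 0) else 0)
      (fun l' : Fin n =>
        let j := π l'.succ
        let c := ampCoeff β (lam j * P) (lam (π 0) * P) (H (some j) (π 0))
        let cs := noiseScale c (H none j)
        if i = 0 then (c : ℂ) * H none j * H (some j) (π 0) / (cs : ℂ)
        else if i = l'.succ then H none (π 0) / (cs : ℂ)
        else 0)
      l

/-- The outage probability `Pr (log₂ det (I + P H Hᴴ) < L R)` of the scheme, with `L = n + 1`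
(the determinant is a real number that is at least `1`). -/
def afOutage {Ω : Type*} [MeasurableSpace Ω] (μ : Measure Ω) {K n : ℕ}
    (A : Option (Fin K) → Fin K → Ω → ℂ) (d : Option (Fin K) → Fin K → ℝ) (γ : ℝ)
    (π : Fin (n + 1) → Fin K) (β : ℝ) (lam : Fin K → ℝ) (R P : ℝ) : ℝ :=
  μ.real {ω |
    let M := afMatrix π (fadingGain d γ (fun m j => A m j ω)) β lam P
    Real.logb 2 (Matrix.det (1 + (((lam (π 0) * P : ℝ) : ℂ)) • (M * M.conjTranspose))).re
      < ((n + 1 : ℕ) : ℝ) * R}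

/-- The outage probability `Pr (log₂ (1 + ∑ P_j |H_{d,j}|²) < R)` of the distributed
`(n + 1) × 1` MIMO channel from the users `π 0, …, π n` to the destination, with independent
Gaussian signals at the transmit antennas. -/
def mimoOutage {Ω : Type*} [MeasurableSpace Ω] (μ : Measure Ω) {K n : ℕ}
    (A : Option (Fin K) → Fin K → Ω → ℂ) (d : Option (Fin K) → Fin K → ℝ) (γ : ℝ)
    (π : Fin (n + 1) → Fin K) (lam : Fin K → ℝ) (R P : ℝ) : ℝ :=
  μ.real {ω |
    Real.logb 2 (1 + ∑ l : Fin (n + 1),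
      lam (π l) * P * ‖fadingGain d γ (fun m j => A m j ω) none (π l)‖ ^ 2) < R}

/-- An outage probability, as a function of the power, has diversity order `δ` if
`-log p(P) / log P → δ` as `P → ∞`. -/
def HasDiversityOrder (p : ℝ → ℝ) (δ : ℝ) : Prop :=
  Tendsto (fun P : ℝ => -Real.log (p P) / Real.log P) atTop (𝓝 δ)

end

/-! Let u, S_l and w_l be the instantaneous SNRs from source to destination, from relay l to
destination and from source to relay l. The channel matrix is an arrow, so the determinant is
explicit (`afDet`), and u, S_l, w_l are independent exponential variables of mean proportional to P.

Lower bound: pathwise `afDet` ≤ (1 + u + ∑ S_l)^L (`afDet_le`), so MIMO outage at rate R forces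
outage at rate LR. MIMO outage means that a sum of L independent exponentials falls below t = (2^R -
1)/P. On (0, t) a density of rate ρ lies between ρ e^{-ρt} and ρ, so the probability is (∏ ρ) t^L /
L! up to a relative error O(t).

Upper bound: `afDet` ≥ 1 + u + ∑ S_l w_l / (1 + S_l + w_l), and a summand is nearly min(S_l, w_l)
once the larger hop is strong. So in outage either both hops of some relay are weak, which involves
L + 1 independent links and has probability O(P^{-L-1}), or u plus the weaker hops is below about T
= 2^{LR} - 1. Summing over the 2^{L-1} choices of weaker hops gives exactly the claimed constant,
with no room for the error terms. The fresh symbols provide the room: if a weak hop leads to the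
destination, little relay noise arrives, the fresh symbol adds at least u/2, and the constant drops
strictly (`exists_weak_hops_of_afDet_lt`, `eventually_measureReal_afDet_lt_le`). The diversity order
follows from the two bounds. -/

/-! ### The determinant of the scheme -/

/-- The determinant of a positive multiple of `M Mᴴ` shifted by the identity, for the arrow-shaped
matrix `M` with first column `x` and remaining diagonal entries `y`. -/
theorem det_one_add_smul_arrow {n : ℕ} (M : Matrix (Fin (n + 1)) (Fin (n + 1)) ℂ)
    (x : Fin (n + 1) → ℂ) (y : Fin n → ℂ) (h0 : ∀ l, M l 0 = x l) (h1 : ∀ i : Fin n, M 0 i.succ = 0)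
    (h2 : ∀ l i : Fin n, M l.succ i.succ = if i = l then y l else 0) {p : ℝ} (hp : 0 ≤ p) :
    Matrix.det (1 + (p : ℂ) • (M * M.conjTranspose)) =
      (((∏ l, (1 + p * ‖y l‖ ^ 2)) *
        (1 + p * ‖x 0‖ ^ 2 + ∑ l : Fin n, p * ‖x l.succ‖ ^ 2 / (1 + p * ‖y l‖ ^ 2)) : ℝ) : ℂ) := by
  -- The columns after the first have one nonzero entry each, so they only add to the diagonal, and
  -- not at index 0. The first column is a rank-one update, handled by the matrix determinant lemma.
  set e : Fin (n + 1) → ℝ := Fin.cons 1 (fun l => 1 + p * ‖y l‖ ^ 2) with he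
  have hepos : ∀ l, 0 < e l := by
    intro l
    refine Fin.cases ?_ (fun l => ?_) l
    · simp [he]
    · simp only [he, Fin.cons_succ]; positivity
  have key : 1 + (p : ℂ) • (M * M.conjTranspose) =
      Matrix.diagonal (fun l => (e l : ℂ)) +
        Matrix.replicateCol Unit (fun l => (p : ℂ) * x l) *
          Matrix.replicateRow Unit (fun l => star (x l)) := by
    ext l m
    simp only [Matrix.add_apply, Matrix.smul_apply, Matrix.mul_apply, Matrix.conjTranspose_apply,
      Fin.sum_univ_succ, h0, smul_eq_mul, Matrix.replicateCol_apply, Matrix.replicateRow_apply,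
      Finset.univ_unique, Finset.sum_singleton]
    refine Fin.cases ?_ (fun l => ?_) l <;> refine Fin.cases ?_ (fun m => ?_) m
    · simp [he, h1]; ring
    · simp [h1, (Fin.succ_ne_zero _).symm]; ring
    · simp [h1]; ring
    · simp only [h2]
      by_cases hlm : l = m
      · subst hlm
        have : (y l) * (starRingEnd ℂ) (y l) = ((‖y l‖ ^ 2 : ℝ) : ℂ) := by
          rw [Complex.mul_conj, Complex.normSq_eq_norm_sq]
        simp [he, mul_add, this]; ring
      · simp [hlm]; ring
  have hdet : (Matrix.diagonal (fun l => (e l : ℂ))).det = ((∏ l, e l : ℝ) : ℂ) := by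
    simp [Matrix.det_diagonal]
  have hne : ∀ l, (e l : ℂ) ≠ 0 := fun l => by exact_mod_cast (hepos l).ne'
  have hinv : (Matrix.diagonal (fun l => (e l : ℂ)))⁻¹ = Matrix.diagonal (fun l => (e l : ℂ)⁻¹) := by
    apply Matrix.inv_eq_right_inv
    rw [Matrix.diagonal_mul_diagonal]
    simp [hne]
  rw [key, Matrix.det_add_replicateCol_mul_replicateRow, hinv, hdet]
  · rw [Matrix.det_unique]
    simp only [Matrix.add_apply, Matrix.one_apply_eq, Matrix.mul_apply, Matrix.replicateRow_apply,
      Matrix.replicateCol_apply, Matrix.diagonal_apply, mul_ite, mul_zero, Finset.sum_ite_eq',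
      Finset.mem_univ, if_true]
    have : ∀ l, star (x l) * (e l : ℂ)⁻¹ * (p * x l) = ((p * ‖x l‖ ^ 2 / e l : ℝ) : ℂ) := by
      intro l
      have : (x l) * (starRingEnd ℂ) (x l) = ((‖x l‖ ^ 2 : ℝ) : ℂ) := by
        rw [Complex.mul_conj, Complex.normSq_eq_norm_sq]
      push_cast at this ⊢
      rw [← this, div_eq_mul_inv, ← starRingEnd_apply]; ring
    simp only [this]
    rw [Fin.prod_univ_succ, Fin.sum_univ_succ]
    simp [he, add_assoc]
  · rw [hdet]
    exact (Complex.ofReal_ne_zero.2 (Finset.prod_pos fun l _ => hepos l).ne').isUnit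

/-- The determinant of the scheme in terms of the signal-to-noise ratios `u` from source to
destination, `S l` from relay to destination and `w l` from source to relay. -/
noncomputable def afDet {n : ℕ} (β u : ℝ) (S w : Fin n → ℝ) : ℝ :=
  (∏ l, (1 + u / (1 + β * S l / (w l + 1)))) *
    (1 + u + ∑ l, (β * S l / (w l + 1) * w l / (1 + β * S l / (w l + 1))) /
      (1 + u / (1 + β * S l / (w l + 1))))

theorem det_afMatrix {K n : ℕ} (π : Fin (n + 1) → Fin K) (H : Option (Fin K) → Fin K → ℂ)
    {β : ℝ} (hβ : 0 ≤ β) (lam : Fin K → ℝ) (hlam : ∀ j, 0 < lam j) (hlam0 : lam (π 0) = 1)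
    {P : ℝ} (hP : 0 < P) :
    (Matrix.det (1 + (((lam (π 0) * P : ℝ) : ℂ)) •
      (afMatrix π H β lam P * (afMatrix π H β lam P).conjTranspose))).re =
    afDet β (P * ‖H none (π 0)‖ ^ 2)
      (fun l : Fin n => P * (lam (π l.succ) * ‖H none (π l.succ)‖ ^ 2))
      (fun l : Fin n => P * ‖H (some (π l.succ)) (π 0)‖ ^ 2) := by
  rw [hlam0, one_mul, det_one_add_smul_arrow (afMatrix π H β lam P) (fun l => afMatrix π H β lam P l 0)
    (fun l => H none (π 0) / (noiseScale (ampCoeff β (lam (π l.succ) * P) (lam (π 0) * P)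
        (H (some (π l.succ)) (π 0))) (H none (π l.succ)) : ℂ)) (fun _ => rfl) _ _ hP.le,
    Complex.ofReal_re]
  rotate_left
  · intro i; simp [afMatrix]
  · intro l i; simp [afMatrix, Fin.succ_inj]
  have hc : ∀ l : Fin n, ampCoeff β (lam (π l.succ) * P) (lam (π 0) * P)
        (H (some (π l.succ)) (π 0)) ^ 2 =
      β * (lam (π l.succ) * P) / (P * ‖H (some (π l.succ)) (π 0)‖ ^ 2 + 1) := by
    intro l
    have := hlam (π l.succ)
    rw [ampCoeff, Real.sq_sqrt (by rw [hlam0]; positivity), hlam0, one_mul, mul_comm P]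
  have hcs : ∀ l : Fin n, noiseScale (ampCoeff β (lam (π l.succ) * P) (lam (π 0) * P)
        (H (some (π l.succ)) (π 0))) (H none (π l.succ)) ^ 2 =
      1 + β * (P * (lam (π l.succ) * ‖H none (π l.succ)‖ ^ 2)) /
        (P * ‖H (some (π l.succ)) (π 0)‖ ^ 2 + 1) := by
    intro l
    rw [noiseScale, Real.sq_sqrt (by positivity), norm_mul, mul_pow, Complex.norm_real,
      Real.norm_eq_abs, sq_abs, hc]
    ring
  have hy : ∀ l : Fin n, P * ‖H none (π 0) / (noiseScale (ampCoeff β (lam (π l.succ) * P)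
      (lam (π 0) * P) (H (some (π l.succ)) (π 0))) (H none (π l.succ)) : ℂ)‖ ^ 2 =
      P * ‖H none (π 0)‖ ^ 2 / (1 + β * (P * (lam (π l.succ) * ‖H none (π l.succ)‖ ^ 2)) /
        (P * ‖H (some (π l.succ)) (π 0)‖ ^ 2 + 1)) := by
    intro l
    rw [norm_div, div_pow, Complex.norm_real, Real.norm_eq_abs, sq_abs, hcs, ← mul_div_assoc]
  have hx : ∀ l : Fin n, P * ‖afMatrix π H β lam P l.succ 0‖ ^ 2 =
      β * (P * (lam (π l.succ) * ‖H none (π l.succ)‖ ^ 2)) /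
        (P * ‖H (some (π l.succ)) (π 0)‖ ^ 2 + 1) * (P * ‖H (some (π l.succ)) (π 0)‖ ^ 2) /
      (1 + β * (P * (lam (π l.succ) * ‖H none (π l.succ)‖ ^ 2)) /
        (P * ‖H (some (π l.succ)) (π 0)‖ ^ 2 + 1)) := by
    intro l
    simp only [afMatrix, Matrix.of_apply, Fin.cases_succ, if_true]
    rw [norm_div, div_pow, Complex.norm_real (noiseScale _ _), Real.norm_eq_abs, sq_abs, hcs,
      norm_mul, norm_mul, mul_pow, mul_pow, Complex.norm_real, Real.norm_eq_abs, sq_abs, hc]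
    ring
  have hx0 : afMatrix π H β lam P 0 0 = H none (π 0) := by simp [afMatrix]
  simp only [hy, hx, hx0, afDet]

/-! ### Pathwise bounds on the determinant -/

/-- Each factor of the product is at most 1 + u, and the denominator of summand l cancels factor l.
What remains are the first two terms of the binomial expansion of the right-hand side, the factor `n
+ 1` there absorbing β. -/
theorem afDet_le {n : ℕ} {β u : ℝ} {S w : Fin n → ℝ} (hβ : 0 ≤ β)
    (hβ2 : β ≤ max 2 ((n + 1 : ℕ) : ℝ)) (hu : 0 ≤ u) (hS : ∀ l, 0 ≤ S l) (hw : ∀ l, 0 ≤ w l) :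
    afDet β u S w ≤ (1 + u + ∑ l, S l) ^ (n + 1) := by
  have hv : ∀ l, 0 ≤ β * S l / (w l + 1) := fun l => by
    have := hS l; have := hw l; positivity
  unfold afDet
  set v : Fin n → ℝ := fun l => β * S l / (w l + 1) with hvdef
  set t : Fin n → ℝ := fun l => 1 + u / (1 + v l) with htdef
  have ht1 : ∀ l, 1 ≤ t l := fun l => by
    have := hv l
    have : 0 ≤ u / (1 + v l) := by positivity
    simp only [htdef]; linarith
  have htu : ∀ l, t l ≤ 1 + u := fun l => by
    have : u / (1 + v l) ≤ u := div_le_self hu (by have := hv l; simp only [hvdef]; linarith)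
    simp only [htdef]; linarith
  refine le_trans ?_ (pow_add_mul_le_add_pow (b := ∑ l, S l) (by positivity)
    (by have := Finset.sum_nonneg fun l (_ : l ∈ Finset.univ) => hS l; positivity) (n + 1))
  rw [Nat.add_sub_cancel]
  push_cast
  have hcard : ∀ s : Finset (Fin n), ∏ l ∈ s, t l ≤ (1 + u) ^ s.card := fun s =>
    (Finset.prod_le_prod (fun l _ => zero_le_one.trans (ht1 l)) fun l _ => htu l).trans_eq (by simp)
  rw [mul_add]
  refine add_le_add ?_ ?_
  · have := hcard Finset.univ
    rw [Finset.card_univ, Fintype.card_fin] at this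
    rw [pow_succ]
    exact mul_le_mul_of_nonneg_right this (by positivity)
  · rw [Finset.mul_sum, Finset.mul_sum]
    refine Finset.sum_le_sum fun l _ => ?_
    have hprod : ∏ m, t m = t l * ∏ m ∈ Finset.univ.erase l, t m :=
      (Finset.mul_prod_erase _ _ (Finset.mem_univ l)).symm
    have htl : t l ≠ 0 := (zero_lt_one.trans_le (ht1 l)).ne'
    -- The alternative 2 in the bound on β matters only for `n = 0`, where there is no relay and the
    -- sum is empty.
    have hn : 1 ≤ n := Nat.one_le_iff_ne_zero.2 (by rintro rfl; exact l.elim0)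
    have hβn : β ≤ n + 1 := by
      have : (2 : ℝ) ≤ ((n + 1 : ℕ) : ℝ) := by exact_mod_cast Nat.succ_le_succ hn
      rw [max_eq_right this] at hβ2
      push_cast at hβ2; exact hβ2
    have hq : v l * w l / (1 + v l) ≤ β * S l := by
      have h1 := hv l
      have hw' := hw l
      have hS' := hS l
      calc v l * w l / (1 + v l) ≤ v l * w l := div_le_self (by positivity) (by
            simp only [hvdef]; linarith)
        _ = β * S l * (w l / (w l + 1)) := by simp only [hvdef]; ring
        _ ≤ β * S l * 1 := by
            gcongr
            rw [div_le_one (by positivity)]; linarith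
        _ = β * S l := mul_one _
    have hE := hcard (Finset.univ.erase l)
    have hE2 : ∏ m ∈ Finset.univ.erase l, t m ≤ (1 + u) ^ n := by
      refine hE.trans (pow_le_pow_right₀ (by linarith) ?_)
      exact (Finset.card_le_univ _).trans (by simp)
    change (∏ m, t m) * (v l * w l / (1 + v l) / t l) ≤ _
    calc (∏ m, t m) * (v l * w l / (1 + v l) / t l)
        = (∏ m ∈ Finset.univ.erase l, t m) * (v l * w l / (1 + v l)) := by
          rw [hprod]; field_simp
      _ ≤ (1 + u) ^ n * (β * S l) := by
          refine mul_le_mul hE2 hq ?_ (by positivity)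
          have := hv l; have := hw l; positivity
      _ ≤ (1 + u) ^ n * ((n + 1) * S l) := by
          gcongr; exact hS l
      _ = _ := by ring

/-- Two lower bounds on the determinant, the second one keeping the contribution of one fresh
symbol. -/
theorem le_afDet {n : ℕ} {β u : ℝ} {S w : Fin n → ℝ} (hβ : 1 ≤ β)
    (hu : 0 ≤ u) (hS : ∀ l, 0 ≤ S l) (hw : ∀ l, 0 ≤ w l) :
    1 + u + ∑ l, S l * w l / (1 + S l + w l) ≤ afDet β u S w ∧
    ∀ l₀, 1 + u + u / (1 + β * S l₀ / (w l₀ + 1)) + ∑ l, S l * w l / (1 + S l + w l) ≤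
      afDet β u S w := by
  have hv : ∀ l, 0 ≤ β * S l / (w l + 1) := fun l => by
    have := hS l; have := hw l; positivity
  unfold afDet
  set v : Fin n → ℝ := fun l => β * S l / (w l + 1) with hvdef
  set t : Fin n → ℝ := fun l => 1 + u / (1 + v l) with htdef
  have hv0 : ∀ l, 0 ≤ u / (1 + v l) := fun l => by
    have := hv l; positivity
  have ht1 : ∀ l, 1 ≤ t l := fun l => by
    have := hv0 l
    simp only [htdef]; linarith
  have hsum : ∑ l, S l * w l / (1 + S l + w l) ≤
      (∏ m, t m) * ∑ l, (v l * w l / (1 + v l) / t l) := by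
    rw [Finset.mul_sum]
    refine Finset.sum_le_sum fun l _ => ?_
    have hprod : ∏ m, t m = t l * ∏ m ∈ Finset.univ.erase l, t m :=
      (Finset.mul_prod_erase _ _ (Finset.mem_univ l)).symm
    have htl : t l ≠ 0 := (zero_lt_one.trans_le (ht1 l)).ne'
    have h1 := hv l
    have hw' := hw l
    have hS' := hS l
    have hq : S l * w l / (1 + S l + w l) ≤ v l * w l / (1 + v l) := by
      have : v l * w l / (1 + v l) = β * S l * w l / (w l + 1 + β * S l) := by
        simp only [hvdef]; field_simp
      rw [this, div_le_div_iff₀ (by positivity) (by positivity)]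
      -- This is exactly the difference of the two sides after cross-multiplication.
      have h2 : 0 ≤ (β - 1) * (S l * w l * (1 + w l)) :=
        mul_nonneg (by linarith) (by positivity)
      nlinarith [h2]
    have hE : 1 ≤ ∏ m ∈ Finset.univ.erase l, t m := Finset.one_le_prod fun m _ => ht1 m
    calc S l * w l / (1 + S l + w l) ≤ v l * w l / (1 + v l) := hq
      _ = 1 * (v l * w l / (1 + v l)) := (one_mul _).symm
      _ ≤ (∏ m ∈ Finset.univ.erase l, t m) * (v l * w l / (1 + v l)) := by
          refine mul_le_mul_of_nonneg_right hE ?_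
          exact div_nonneg (mul_nonneg h1 hw') (by simp only [hvdef]; linarith)
      _ = _ := by rw [hprod]; field_simp
  have hone : 1 ≤ ∏ m, t m := Finset.one_le_prod fun m _ => ht1 m
  have hfirst : 1 + u ≤ (∏ m, t m) * (1 + u) := le_mul_of_one_le_left (by positivity) hone
  refine ⟨?_, fun l₀ => ?_⟩
  · rw [mul_add]; exact add_le_add hfirst hsum
  · rw [mul_add]
    refine add_le_add ?_ hsum
    have hprod : ∏ m, t m = t l₀ * ∏ m ∈ Finset.univ.erase l₀, t m :=
      (Finset.mul_prod_erase _ _ (Finset.mem_univ l₀)).symm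
    have hE : 1 ≤ ∏ m ∈ Finset.univ.erase l₀, t m := Finset.one_le_prod fun m _ => ht1 m
    have hge : t l₀ ≤ ∏ m, t m := by
      rw [hprod]; exact le_mul_of_one_le_right (zero_le_one.trans (ht1 l₀)) hE
    -- One factor of the product is kept: it carries the fresh symbol of slot `l₀`.
    calc 1 + u + u / (1 + v l₀) ≤ t l₀ * (1 + u) := by
          simp only [htdef]; nlinarith [mul_nonneg (hv0 l₀) hu]
      _ ≤ _ := mul_le_mul_of_nonneg_right hge (by positivity)

/-! ### Sums of independent variables with bounded densities -/

/-- `C * t ^ m / m !` for positive `t`, and zero otherwise: the volume of a simplex. -/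
noncomputable def simplexVol (C : ℝ) (m : ℕ) (t : ℝ) : ENNReal :=
  if 0 < t then ENNReal.ofReal (C * t ^ m / (m.factorial : ℝ)) else 0

/-- A simplex is sliced along one coordinate. The freedom in `D` serves both the upper bound, with
density on the half-line, and the lower bound, with density known only near zero. -/
theorem setLIntegral_simplexVol {C : ℝ} (hC : 0 ≤ C) (m : ℕ) {s : ℝ} {D : Set ℝ}
    (hD : MeasurableSet D) (h1 : Set.Ioo 0 s ⊆ D) (h2 : D ⊆ Set.Ioi 0) :
    ∫⁻ x in D, simplexVol C m (s - x) = simplexVol C (m + 1) s := by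
  have : D.indicator (fun x => simplexVol C m (s - x)) =
      (Set.Ioo 0 s).indicator fun x =>
        ENNReal.ofReal (C * (s - x) ^ m / (m.factorial : ℝ)) := by
    ext x
    by_cases hx : x ∈ Set.Ioo 0 s
    · rw [Set.indicator_of_mem (h1 hx), Set.indicator_of_mem hx, simplexVol,
        if_pos (sub_pos.2 hx.2)]
    · rw [Set.indicator_of_notMem hx]
      by_cases hxD : x ∈ D
      · rw [Set.indicator_of_mem hxD, simplexVol, if_neg]
        intro h
        exact hx ⟨h2 hxD, sub_pos.1 h⟩
      · rw [Set.indicator_of_notMem hxD]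
  rw [← lintegral_indicator hD, this, lintegral_indicator measurableSet_Ioo]
  by_cases hs : 0 < s
  · rw [simplexVol, if_pos hs, ← ofReal_integral_eq_lintegral_ofReal]
    · congr 1
      rw [← integral_Ioc_eq_integral_Ioo, ← intervalIntegral.integral_of_le hs.le,
        intervalIntegral.integral_comp_sub_left (fun y => C * y ^ m / (m.factorial : ℝ)) s]
      simp only [sub_self, sub_zero]
      rw [intervalIntegral.integral_div, intervalIntegral.integral_const_mul, integral_pow,
        Nat.factorial_succ]
      push_cast
      have : (m.factorial : ℝ) ≠ 0 := by positivity
      field_simp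
      ring
    · refine (Continuous.integrableOn_Icc ?_).mono_set Set.Ioo_subset_Icc_self
      fun_prop
    · refine (ae_restrict_iff' measurableSet_Ioo).2 (Eventually.of_forall fun x hx => ?_)
      have := sub_nonneg.2 hx.2.le
      simp only [Pi.zero_apply]
      positivity
  · rw [simplexVol, if_neg hs, Set.Ioo_eq_empty hs]
    simp

section SumOfIndependent

variable {Ω : Type*} [MeasurableSpace Ω] {μ : Measure Ω}

theorem measure_add_lt_eq_lintegral [IsProbabilityMeasure μ]
    {X Y : Ω → ℝ} (hX : AEMeasurable X μ) (hY : AEMeasurable Y μ)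
    (h : IndepFun X Y μ) (s : ℝ) :
    μ {ω | X ω + Y ω < s} = ∫⁻ x, μ {ω | Y ω < s - x} ∂(μ.map X) := by
  have hm : MeasurableSet {p : ℝ × ℝ | p.1 + p.2 < s} :=
    measurableSet_lt (by fun_prop) (by fun_prop)
  have h1 : μ {ω | X ω + Y ω < s} = μ.map (fun ω => (X ω, Y ω)) {p : ℝ × ℝ | p.1 + p.2 < s} := by
    rw [Measure.map_apply_of_aemeasurable (hX.prodMk hY) hm]; rfl
  rw [h1, (indepFun_iff_map_prod_eq_prod_map_map hX hY).1 h, Measure.prod_apply hm]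
  refine lintegral_congr fun x => ?_
  rw [Measure.map_apply_of_aemeasurable hY (by
    exact measurable_prodMk_left hm)]
  congr 1
  ext ω
  simp [lt_sub_iff_add_lt']

/-- Induction on the summands, conditioning on one of them; domination of each law is enough. -/
theorem measure_sum_lt_le [IsProbabilityMeasure μ]
    {ι : Type*} {X : ι → Ω → ℝ} (hX : ∀ i, AEMeasurable (X i) μ)
    (hind : iIndepFun X μ) {r : ι → ℝ} (hr : ∀ i, 0 ≤ r i)
    (hlaw : ∀ i, μ.map (X i) ≤ ENNReal.ofReal (r i) • volume.restrict (Set.Ioi 0))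
    (s : Finset ι) (t : ℝ) :
    μ {ω | ∑ i ∈ s, X i ω < t} ≤ simplexVol (∏ i ∈ s, r i) s.card t := by
  classical
  induction s using Finset.induction_on generalizing t with
  | empty =>
    by_cases ht : 0 < t
    · simp [simplexVol, ht]
    · simp [simplexVol, ht]
  | insert i s his ih =>
    have hI : IndepFun (X i) (fun ω => ∑ j ∈ s, X j ω) μ := by
      have := (hind.indepFun_finsetSum_of_notMem₀ hX his).symm
      convert this using 1
      ext ω; simp
    simp only [Finset.sum_insert his]
    rw [measure_add_lt_eq_lintegral (hX i) (Finset.aemeasurable_fun_sum s fun j _ => hX j) hI]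
    calc ∫⁻ x, μ {ω | ∑ j ∈ s, X j ω < t - x} ∂(μ.map (X i))
        ≤ ∫⁻ x, simplexVol (∏ j ∈ s, r j) s.card (t - x) ∂(μ.map (X i)) :=
          lintegral_mono fun x => ih (t - x)
      _ ≤ ∫⁻ x, simplexVol (∏ j ∈ s, r j) s.card (t - x)
            ∂(ENNReal.ofReal (r i) • volume.restrict (Set.Ioi 0)) :=
          lintegral_mono' (hlaw i) le_rfl
      _ = ENNReal.ofReal (r i) * simplexVol (∏ j ∈ s, r j) (s.card + 1) t := by
          rw [lintegral_smul_measure, setLIntegral_simplexVol (Finset.prod_nonneg fun j _ => hr j)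
            _ measurableSet_Ioi Set.Ioo_subset_Ioi_self le_rfl, smul_eq_mul]
      _ = simplexVol (∏ j ∈ insert i s, r j) (insert i s).card t := by
          rw [Finset.prod_insert his, Finset.card_insert_of_notMem his, simplexVol, simplexVol]
          split_ifs with ht
          · rw [← ENNReal.ofReal_mul (hr i)]; congr 1; ring
          · simp

theorem le_measure_sum_lt [IsProbabilityMeasure μ]
    {ι : Type*} {X : ι → Ω → ℝ} (hX : ∀ i, AEMeasurable (X i) μ)
    (hind : iIndepFun X μ) {r : ι → ℝ} (hr : ∀ i, 0 ≤ r i) {t₀ : ℝ}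
    (hlaw : ∀ i, ENNReal.ofReal (r i) • volume.restrict (Set.Ioo 0 t₀) ≤ μ.map (X i))
    (s : Finset ι) {t : ℝ} (ht : t ≤ t₀) :
    simplexVol (∏ i ∈ s, r i) s.card t ≤ μ {ω | ∑ i ∈ s, X i ω < t} := by
  classical
  induction s using Finset.induction_on generalizing t with
  | empty =>
    by_cases ht : 0 < t
    · simp [simplexVol, ht]
    · simp [simplexVol, ht]
  | insert i s his ih =>
    have hI : IndepFun (X i) (fun ω => ∑ j ∈ s, X j ω) μ := by
      have := (hind.indepFun_finsetSum_of_notMem₀ hX his).symm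
      convert this using 1
      ext ω; simp
    simp only [Finset.sum_insert his]
    rw [measure_add_lt_eq_lintegral (hX i) (Finset.aemeasurable_fun_sum s fun j _ => hX j) hI]
    calc simplexVol (∏ j ∈ insert i s, r j) (insert i s).card t
        = ENNReal.ofReal (r i) * simplexVol (∏ j ∈ s, r j) (s.card + 1) t := by
          rw [Finset.prod_insert his, Finset.card_insert_of_notMem his, simplexVol, simplexVol]
          split_ifs with ht
          · rw [← ENNReal.ofReal_mul (hr i)]; congr 1; ring
          · simp
      _ = ∫⁻ x, simplexVol (∏ j ∈ s, r j) s.card (t - x)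
            ∂(ENNReal.ofReal (r i) • volume.restrict (Set.Ioo 0 t₀)) := by
          rw [lintegral_smul_measure, setLIntegral_simplexVol (Finset.prod_nonneg fun j _ => hr j)
            _ measurableSet_Ioo (Set.Ioo_subset_Ioo_right ht) Set.Ioo_subset_Ioi_self, smul_eq_mul]
      -- Conditioning on a positive value only lowers the threshold, so it stays below `t₀`.
      _ ≤ ∫⁻ x, μ {ω | ∑ j ∈ s, X j ω < t - x}
            ∂(ENNReal.ofReal (r i) • volume.restrict (Set.Ioo 0 t₀)) := by
          rw [lintegral_smul_measure, lintegral_smul_measure]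
          gcongr 1
          refine setLIntegral_mono' measurableSet_Ioo fun x hx => ih ?_
          linarith [hx.1]
      _ ≤ ∫⁻ x, μ {ω | ∑ j ∈ s, X j ω < t - x} ∂(μ.map (X i)) :=
          lintegral_mono' (hlaw i) le_rfl

theorem measure_forall_lt_le {ι : Type*} [Fintype ι] {X : ι → Ω → ℝ}
    (hX : ∀ i, AEMeasurable (X i) μ) (hind : iIndepFun X μ) {r : ι → ℝ} (hr : ∀ i, 0 ≤ r i)
    (hlaw : ∀ i, μ.map (X i) ≤ ENNReal.ofReal (r i) • volume.restrict (Set.Ioi 0)) (q : ℝ) :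
    μ {ω | ∀ i, X i ω < q} ≤ ∏ i, ENNReal.ofReal (r i * q) := by
  have h := hind.measure_inter_preimage_eq_mul Finset.univ (sets := fun _ => Set.Iio q)
    fun _ _ => measurableSet_Iio
  have hset : {ω | ∀ i, X i ω < q} = ⋂ i ∈ Finset.univ, X i ⁻¹' Set.Iio q := by
    ext ω; simp
  rw [hset, h]
  refine Finset.prod_le_prod' fun i _ => ?_
  rw [← Measure.map_apply_of_aemeasurable (hX i) measurableSet_Iio]
  refine (hlaw i _).trans_eq ?_
  rw [Measure.smul_apply, Measure.restrict_apply measurableSet_Iio, Set.inter_comm, Set.Ioi_inter_Iio,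
    Real.volume_Ioo, sub_zero, smul_eq_mul, ENNReal.ofReal_mul (hr i)]

end SumOfIndependent

/-! ### From complex Gaussian gains to exponential variables -/

theorem gaussianPDF_half_mul (x y : ℝ) :
    gaussianPDF 0 (1 / 2) x * gaussianPDF 0 (1 / 2) y =
      ENNReal.ofReal (Real.pi⁻¹ * Real.exp (-(x ^ 2 + y ^ 2))) := by
  have hpi := Real.pi_pos
  rw [gaussianPDF, gaussianPDF, ← ENNReal.ofReal_mul (gaussianPDFReal_nonneg _ _ _)]
  congr 1
  simp only [gaussianPDFReal]
  have h : (2 * Real.pi * ((1 / 2 : NNReal) : ℝ)) = Real.pi := by push_cast; ring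
  have h2 : (2 * ((1 / 2 : NNReal) : ℝ)) = 1 := by push_cast; ring
  rw [h, h2]
  have hs : (√Real.pi)⁻¹ * (√Real.pi)⁻¹ = Real.pi⁻¹ := by
    rw [← mul_inv, Real.mul_self_sqrt hpi.le]
  rw [mul_mul_mul_comm, hs, ← Real.exp_add]
  congr 2
  ring

/-- Polar coordinates: the angle contributes 2π against the normalisation 1/π. -/
theorem lintegral_gaussian_prod_radial {g : ℝ → ENNReal} (hg : Measurable g) :
    ∫⁻ p : ℝ × ℝ, g (p.1 ^ 2 + p.2 ^ 2)
      ∂((gaussianReal 0 (1 / 2)).prod (gaussianReal 0 (1 / 2))) =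
    ∫⁻ r in Set.Ioi (0 : ℝ), ENNReal.ofReal (2 * r * Real.exp (-r ^ 2)) * g (r ^ 2) := by
  have hpi := Real.pi_pos
  have hv : (1 / 2 : NNReal) ≠ 0 := by norm_num
  rw [gaussianReal_of_var_ne_zero _ hv,
    prod_withDensity (measurable_gaussianPDF _ _) (measurable_gaussianPDF _ _),
    lintegral_withDensity_eq_lintegral_mul _ (by fun_prop) (by fun_prop),
    ← Measure.volume_eq_prod, ← lintegral_comp_polarCoord_symm]
  have hrad : ∀ p : ℝ × ℝ, (polarCoord.symm p).1 ^ 2 + (polarCoord.symm p).2 ^ 2 = p.1 ^ 2 := by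
    intro p
    simp only [polarCoord_symm_apply]
    linear_combination p.1 ^ 2 * Real.sin_sq_add_cos_sq p.2
  simp only [Pi.mul_apply, gaussianPDF_half_mul, hrad, smul_eq_mul]
  rw [polarCoord_target, Measure.volume_eq_prod, ← Measure.prod_restrict,
    lintegral_prod _ (by fun_prop)]
  refine setLIntegral_congr_fun measurableSet_Ioi fun r hr => ?_
  have hr' : 0 < r := hr
  simp only [lintegral_const, Measure.restrict_apply_univ, Real.volume_Ioo]
  rw [← mul_assoc, ← ENNReal.ofReal_mul hr'.le, mul_right_comm, ← ENNReal.ofReal_mul (by positivity)]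
  congr 2
  field_simp
  ring

/-- The squared modulus of a standard complex Gaussian, scaled by `κ`, is exponentially distributed
with rate `κ⁻¹`. -/
theorem map_mul_norm_sq_of_hasLaw {Ω : Type*} [MeasurableSpace Ω] {μ : Measure Ω} {X : Ω → ℂ}
    (hX : HasLaw X stdComplexGaussian μ) {κ : ℝ} (hκ : 0 < κ) :
    μ.map (fun ω => κ * ‖X ω‖ ^ 2) =
      (volume.restrict (Set.Ioi 0)).withDensity fun x =>
        ENNReal.ofReal (κ⁻¹ * Real.exp (-(κ⁻¹ * x))) := by
  have hmc : Measurable fun p : ℝ × ℝ => (⟨p.1, p.2⟩ : ℂ) :=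
    Complex.measurableEquivRealProd.symm.measurable
  have hmn : Measurable fun z : ℂ => κ * ‖z‖ ^ 2 := by fun_prop
  have h1 : μ.map (fun ω => κ * ‖X ω‖ ^ 2) =
      ((gaussianReal 0 (1 / 2)).prod (gaussianReal 0 (1 / 2))).map
        fun p : ℝ × ℝ => κ * (p.1 ^ 2 + p.2 ^ 2) := by
    have := AEMeasurable.map_map_of_aemeasurable hmn.aemeasurable hX.aemeasurable
    rw [Function.comp_def] at this
    rw [← this, hX.map_eq, stdComplexGaussian, Measure.map_map hmn hmc]
    congr 1
    ext p
    simp only [Function.comp_apply]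
    rw [← Complex.normSq_eq_norm_sq, Complex.normSq_apply, sq, sq]
  ext E hE
  have hgm : Measurable fun x : ℝ => E.indicator (fun _ => (1 : ENNReal)) (κ * x) :=
    (measurable_const.indicator hE).comp (by fun_prop)
  rw [h1, ← lintegral_indicator_one hE, ← lintegral_indicator_one hE,
    lintegral_map (measurable_one.indicator hE) (by fun_prop)]
  have := lintegral_gaussian_prod_radial hgm
  change ∫⁻ p : ℝ × ℝ, E.indicator (fun _ => (1 : ENNReal)) (κ * (p.1 ^ 2 + p.2 ^ 2)) ∂_ = _
  rw [this, lintegral_withDensity_eq_lintegral_mul _ (by fun_prop) (measurable_one.indicator hE)]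
  have himg : (fun r : ℝ => κ * r ^ 2) '' Set.Ioi 0 = Set.Ioi 0 := by
    ext x
    constructor
    · rintro ⟨r, hr, rfl⟩
      have : 0 < r := hr
      exact mul_pos hκ (by positivity)
    · intro hx
      have hx' : 0 < x := hx
      refine ⟨√(x / κ), Real.sqrt_pos.2 (by positivity), ?_⟩
      simp only
      rw [Real.sq_sqrt (by positivity)]
      field_simp
  -- The substitution x = κ r² turns 2 r exp(-r²) dr into the exponential law.
  have hcv := lintegral_image_eq_lintegral_abs_deriv_mul (s := Set.Ioi (0 : ℝ))
    (f := fun r => κ * r ^ 2) (f' := fun r => κ * (2 * r)) measurableSet_Ioi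
    (fun x _ => by
      have := ((hasDerivAt_pow 2 x).const_mul κ).hasDerivWithinAt (s := Set.Ioi 0)
      simpa using this)
    (fun x hx y hy h => by
      have h' : x ^ 2 = y ^ 2 := mul_left_cancel₀ hκ.ne' h
      exact (pow_left_inj₀ (le_of_lt hx) (le_of_lt hy) two_ne_zero).1 h')
  rw [himg] at hcv
  refine Eq.trans ?_ (hcv _).symm
  refine setLIntegral_congr_fun measurableSet_Ioi fun r hr => ?_
  have hr' : 0 < r := hr
  simp only [Pi.mul_apply]
  rw [← mul_assoc, ← ENNReal.ofReal_mul (abs_nonneg _), abs_of_pos (by positivity),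
    inv_mul_cancel_left₀ hκ.ne']
  congr 2
  field_simp

theorem exponential_le {ρ : ℝ} (hρ : 0 ≤ ρ) :
    ((volume.restrict (Set.Ioi 0)).withDensity fun x : ℝ =>
        ENNReal.ofReal (ρ * Real.exp (-(ρ * x)))) ≤
      ENNReal.ofReal ρ • volume.restrict (Set.Ioi 0) := by
  rw [← withDensity_const]
  refine withDensity_mono ?_
  refine (ae_restrict_iff' measurableSet_Ioi).2 (Eventually.of_forall fun x hx => ?_)
  have hx' : 0 < x := hx
  refine ENNReal.ofReal_le_ofReal (mul_le_of_le_one_right hρ ?_)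
  rw [Real.exp_le_one_iff]
  nlinarith [mul_nonneg hρ hx'.le]

theorem le_exponential {ρ : ℝ} (hρ : 0 ≤ ρ) (t : ℝ) :
    ENNReal.ofReal (ρ * Real.exp (-(ρ * t))) • volume.restrict (Set.Ioo 0 t) ≤
      (volume.restrict (Set.Ioi 0)).withDensity fun x : ℝ =>
        ENNReal.ofReal (ρ * Real.exp (-(ρ * x))) := by
  have h1 : (volume.restrict (Set.Ioo 0 t)).withDensity (fun x : ℝ =>
        ENNReal.ofReal (ρ * Real.exp (-(ρ * x)))) ≤
      (volume.restrict (Set.Ioi 0)).withDensity fun x : ℝ =>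
        ENNReal.ofReal (ρ * Real.exp (-(ρ * x))) := by
    rw [← restrict_withDensity measurableSet_Ioo, ← restrict_withDensity measurableSet_Ioi]
    exact Measure.restrict_mono Set.Ioo_subset_Ioi_self le_rfl
  refine le_trans ?_ h1
  rw [← withDensity_const]
  refine withDensity_mono ?_
  refine (ae_restrict_iff' measurableSet_Ioo).2 (Eventually.of_forall fun x hx => ?_)
  refine ENNReal.ofReal_le_ofReal (mul_le_mul_of_nonneg_left ?_ hρ)
  rw [Real.exp_le_exp]
  nlinarith [mul_le_mul_of_nonneg_left hx.2.le hρ]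

/-- Lets the direct link enter a sum with a weight, which divides its density bound. -/
theorem map_const_mul_le {Ω : Type*} [MeasurableSpace Ω] {μ : Measure Ω} {X : Ω → ℝ}
    (hX : AEMeasurable X μ) {ρ c : ℝ} (hc : 0 < c) (hρ : 0 ≤ ρ)
    (h : μ.map X ≤ ENNReal.ofReal ρ • volume.restrict (Set.Ioi 0)) :
    μ.map (fun ω => c * X ω) ≤ ENNReal.ofReal (ρ / c) • volume.restrict (Set.Ioi 0) := by
  refine Measure.le_iff.2 fun D hD => ?_
  have hcm : Measurable fun x : ℝ => c * x := by fun_prop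
  have hpre : (fun x : ℝ => c * x) ⁻¹' D ∩ Set.Ioi 0 = (fun x : ℝ => c * x) ⁻¹' (D ∩ Set.Ioi 0) := by
    ext x
    simp [hc]
  have hmap := AEMeasurable.map_map_of_aemeasurable hcm.aemeasurable hX
  rw [Function.comp_def] at hmap
  rw [← hmap, Measure.map_apply hcm hD]
  refine (h _).trans_eq ?_
  rw [Measure.smul_apply, Measure.smul_apply, Measure.restrict_apply (hcm hD),
    Measure.restrict_apply hD, hpre, Real.volume_preimage_mul_left hc.ne', smul_eq_mul, smul_eq_mul,
    ← mul_assoc, ← ENNReal.ofReal_mul hρ, abs_of_pos (inv_pos.2 hc), div_eq_mul_inv]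

/-! ### Weak hops and the upper bound on the outage probability -/

/-- The weight of the direct link when every relay has a weak hop, `true` marking the hop to the
destination: it is raised if some relay does not disturb the fresh symbol of the source. -/
noncomputable def directWeight {n : ℕ} (σ : Fin n → Bool) : ℝ :=
  if ∃ l, σ l = true then 3 / 2 else 1

theorem one_le_directWeight {n : ℕ} (σ : Fin n → Bool) : 1 ≤ directWeight σ := by
  unfold directWeight; split_ifs <;> norm_num

/-- When the determinant is small, then either the weak hops and the direct link are jointly weak,
or both hops of some relay are weak. -/
theorem exists_weak_hops_of_afDet_lt {n : ℕ} {β T B δ : ℝ} (hβ : 1 ≤ β) (hT : 0 < T) (hδ : 0 < δ)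
    (hδ1 : δ < 1) (hB1 : 2 * T + 2 ≤ δ * B) (hB2 : β * (2 * T + 1) ≤ B)
    {G : Option (Fin n × Bool) → ℝ} (hG : ∀ o, 0 ≤ G o)
    (h : afDet β (G none) (fun l => G (some (l, true))) (fun l => G (some (l, false))) < 1 + T) :
    ∃ σ : Fin n → Bool,
      (1 - δ) * (directWeight σ * G none + ∑ l, G (some (l, σ l))) < T ∨
      ∃ l, G none < B ∧ (∀ m, G (some (m, σ m)) < B) ∧ G (some (l, !σ l)) < B := by
  obtain ⟨hlow, hlow'⟩ := le_afDet (β := β) (u := G none) (S := fun l => G (some (l, true)))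
    (w := fun l => G (some (l, false))) hβ (hG _) (fun _ => hG _) (fun _ => hG _)
  have hB : 2 * T + 1 ≤ B := by nlinarith
  set f : Fin n → ℝ := fun l => G (some (l, true)) * G (some (l, false)) /
    (1 + G (some (l, true)) + G (some (l, false))) with hf
  have hf0 : ∀ l, 0 ≤ f l := fun l => by
    have h1 := hG (some (l, true)); have h2 := hG (some (l, false))
    simp only [hf]; positivity
  have hfsum : G none + ∑ l, f l < T := by
    have := hlow.trans_lt h; linarith
  have hsum0 : 0 ≤ ∑ l, f l := Finset.sum_nonneg fun l _ => hf0 l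
  have hfl : ∀ l, f l < T := fun l => by
    have := Finset.single_le_sum (fun l _ => hf0 l) (Finset.mem_univ l)
    have := hG none
    linarith
  -- `σ` selects the weaker hop of each relay.
  set σ : Fin n → Bool := fun l => decide (G (some (l, true)) ≤ G (some (l, false))) with hσ
  have hmin : ∀ l, G (some (l, σ l)) ≤ G (some (l, !σ l)) := fun l => by
    by_cases hl : G (some (l, true)) ≤ G (some (l, false))
    · simp [hσ, hl]
    · simp [hσ, hl, (not_le.1 hl).le]
  have hfeq : ∀ l, f l = G (some (l, σ l)) * G (some (l, !σ l)) /
      (1 + G (some (l, σ l)) + G (some (l, !σ l))) := fun l => by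
    cases hl : σ l
    · simp only [hf, Bool.not_false]; ring
    · simp only [hf, Bool.not_true]
  have hY : ∀ l, G (some (l, σ l)) < 2 * T + 1 := fun l => by
    have h1 := hfl l
    have h2 := hmin l
    have h3 := hG (some (l, σ l))
    rw [hfeq, div_lt_iff₀ (by linarith)] at h1
    by_contra! h4
    -- For hops y ≤ z one has yz - T(1 + y + z) = (z - y)(y - T) + y(y - 2T - 1) + (y - T),
    -- nonnegative once y ≥ 2T + 1.
    nlinarith [mul_nonneg (sub_nonneg.2 h2) (by linarith : 0 ≤ G (some (l, σ l)) - T),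
      mul_nonneg h3 (by linarith : 0 ≤ G (some (l, σ l)) - (2 * T + 1))]
  refine ⟨σ, ?_⟩
  by_cases hbad : ∃ l, G (some (l, !σ l)) < B
  · obtain ⟨l, hl⟩ := hbad
    exact Or.inr ⟨l, by linarith, fun m => (hY m).trans_le hB, hl⟩
  · left
    push Not at hbad
    have hfge : ∀ l, (1 - δ) * G (some (l, σ l)) ≤ f l := fun l => by
      have h1 := hbad l
      have h2 := hY l
      have h3 := hG (some (l, σ l))
      rw [hfeq, le_div_iff₀ (by linarith)]
      -- Here 1 + y ≤ 2T + 2 ≤ δB ≤ δz for the weak hop y and the strong hop z.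
      have h4 : (1 - δ) * (1 + G (some (l, σ l)) + G (some (l, !σ l))) ≤ G (some (l, !σ l)) := by
        nlinarith [mul_le_mul_of_nonneg_left h1 hδ.le]
      calc _ = G (some (l, σ l)) * ((1 - δ) * (1 + G (some (l, σ l)) + G (some (l, !σ l)))) := by ring
        _ ≤ _ := mul_le_mul_of_nonneg_left h4 h3
    have hsum : (1 - δ) * ∑ l, G (some (l, σ l)) ≤ ∑ l, f l := by
      rw [Finset.mul_sum]; exact Finset.sum_le_sum fun l _ => hfge l
    have h0 := hG none
    unfold directWeight
    split_ifs with hex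
    · obtain ⟨l, hl⟩ := hex
      have hb := hbad l
      have hy := hY l
      rw [hl] at hb hy
      simp only [Bool.not_true] at hb
      -- Since βS ≤ β(2T + 1) ≤ B ≤ w, the scaled noise variance is at most 2, so the fresh symbol
      -- retains half its SNR: hence the weight 3/2.
      have hv : β * G (some (l, true)) / (G (some (l, false)) + 1) ≤ 1 := by
        rw [div_le_one (by linarith)]
        nlinarith
      have hv0 : 0 ≤ β * G (some (l, true)) / (G (some (l, false)) + 1) := by
        have := hG (some (l, true)); have := hG (some (l, false)); positivity
      have hu : G none / 2 ≤ G none / (1 + β * G (some (l, true)) / (G (some (l, false)) + 1)) :=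
        div_le_div_of_nonneg_left h0 (by linarith) (by linarith)
      have := (hlow' l).trans_lt h
      nlinarith [mul_nonneg hδ.le h0]
    · nlinarith [mul_nonneg hδ.le h0]

/-- Collects the contributions of all choices of weak hops into the product of the claimed bound. -/
theorem sum_prod_bool {n : ℕ} (a : Fin n → Bool → ℝ) :
    ∑ σ : Fin n → Bool, ∏ l, a l (σ l) = ∏ l, (a l true + a l false) := by
  have := Finset.prod_univ_sum (fun _ : Fin n => (Finset.univ : Finset Bool)) a
  simp only [Fintype.piFinset_univ, Fintype.sum_bool] at this
  exact this.symm

section Outage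

variable {Ω : Type*} [MeasurableSpace Ω] {μ : Measure Ω} {n : ℕ}
  {E : Option (Fin n × Bool) → Ω → ℝ} {ρ : Option (Fin n × Bool) → ℝ}

theorem measureReal_weak_hops_le [IsProbabilityMeasure μ]
    (hE : ∀ o, AEMeasurable (E o) μ) (hind : iIndepFun E μ)
    (hρ : ∀ o, 0 < ρ o)
    (hlaw : ∀ o, μ.map (E o) ≤ ENNReal.ofReal (ρ o) • volume.restrict (Set.Ioi 0))
    (σ : Fin n → Bool) {c t : ℝ} (hc : 0 < c) (ht : 0 < t) :
    μ.real {ω | c * E none ω + ∑ l, E (some (l, σ l)) ω < t} ≤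
      ρ none / c * (∏ l, ρ (some (l, σ l))) * t ^ (n + 1) / (n + 1).factorial := by
  set e : Option (Fin n) → Option (Fin n × Bool) := Option.map fun l => (l, σ l) with he
  have hinj : Function.Injective e :=
    Option.map_injective fun l m h => (Prod.ext_iff.1 h).1
  set φ : Option (Fin n) → ℝ → ℝ := fun o => o.elim (fun x => c * x) fun _ x => x with hφ
  have hφm : ∀ o, Measurable (φ o) := by
    rintro (_ | l)
    · simp only [hφ, Option.elim_none]; fun_prop
    · simp only [hφ, Option.elim_some]; fun_prop
  set r : Option (Fin n) → ℝ := fun o => o.elim (ρ none / c) fun l => ρ (some (l, σ l)) with hr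
  have hr0 : ∀ o, 0 ≤ r o := by
    rintro (_ | l)
    · exact div_nonneg (hρ none).le hc.le
    · exact (hρ _).le
  have hI : iIndepFun (fun o => φ o ∘ E (e o)) μ := (hind.precomp hinj).comp φ hφm
  have h := measure_sum_lt_le (X := fun o => φ o ∘ E (e o))
    (fun o => (hφm o).comp_aemeasurable (hE _)) hI (r := r) hr0 (by
      rintro (_ | l)
      · exact map_const_mul_le (hE none) hc (hρ none).le (hlaw none)
      · exact hlaw (some (l, σ l))) Finset.univ t
  simp only [Fintype.sum_option, Fintype.prod_option, Finset.card_univ, Fintype.card_option,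
    Fintype.card_fin] at h
  rw [simplexVol, if_pos ht] at h
  refine ENNReal.toReal_le_of_le_ofReal ?_ h
  have h1 := hr0 none
  have h2 : 0 ≤ ∏ l, r (some l) := Finset.prod_nonneg fun l _ => hr0 _
  positivity

/-- The event involves `n + 2` distinct links. With `t` of order 1/P it is one order smaller than
the main term. -/
theorem measureReal_both_hops_weak_le (hE : ∀ o, AEMeasurable (E o) μ) (hind : iIndepFun E μ)
    (hρ : ∀ o, 0 < ρ o)
    (hlaw : ∀ o, μ.map (E o) ≤ ENNReal.ofReal (ρ o) • volume.restrict (Set.Ioi 0))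
    (σ : Fin n → Bool) (l : Fin n) {q t : ℝ} (hq : ∀ o, ρ o ≤ q) (ht : 0 ≤ t) :
    μ.real {ω | E none ω < t ∧ (∀ m, E (some (m, σ m)) ω < t) ∧ E (some (l, !σ l)) ω < t} ≤
      (q * t) ^ (n + 2) := by
  set e : Option (Option (Fin n)) → Option (Fin n × Bool) :=
    fun o => o.elim (some (l, !σ l)) (Option.map fun l => (l, σ l)) with he
  have hinj : Function.Injective e := by
    rintro (_ | _ | m) (_ | _ | m') h <;> simp [he] at h ⊢
    · obtain ⟨rfl, h⟩ := h; simp at h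
    · obtain ⟨rfl, h⟩ := h; simp at h
    · exact h.1
  have h := measure_forall_lt_le (fun o => hE (e o)) (hind.precomp hinj) (fun o => (hρ (e o)).le)
    (fun o => hlaw (e o)) t
  have hq0 : 0 ≤ q := (hρ none).le.trans (hq none)
  refine ENNReal.toReal_le_of_le_ofReal (by positivity) ?_
  calc μ {ω | E none ω < t ∧ (∀ m, E (some (m, σ m)) ω < t) ∧ E (some (l, !σ l)) ω < t}
      ≤ μ {ω | ∀ o, E (e o) ω < t} := by
        refine measure_mono ?_
        rintro ω ⟨h1, h2, h3⟩ (_ | _ | m)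
        · exact h3
        · exact h1
        · exact h2 m
    _ ≤ ∏ o, ENNReal.ofReal (ρ (e o) * t) := h
    _ ≤ ∏ _o : Option (Option (Fin n)), ENNReal.ofReal (q * t) :=
        Finset.prod_le_prod' fun o _ => ENNReal.ofReal_le_ofReal
          (mul_le_mul_of_nonneg_right (hq _) ht)
    _ = ENNReal.ofReal ((q * t) ^ (n + 2)) := by
        rw [Finset.prod_const, Finset.card_univ, Fintype.card_option, Fintype.card_option,
          Fintype.card_fin, ENNReal.ofReal_pow (by positivity)]

theorem eventually_measureReal_afDet_lt_le [IsProbabilityMeasure μ]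
    (hE : ∀ o, AEMeasurable (E o) μ)
    (hE0 : ∀ o ω, 0 ≤ E o ω) (hind : iIndepFun E μ) (hρ : ∀ o, 0 < ρ o)
    (hlaw : ∀ o, μ.map (E o) ≤ ENNReal.ofReal (ρ o) • volume.restrict (Set.Ioi 0))
    {β T : ℝ} (hβ : 1 ≤ β) (hT : 0 < T) :
    ∀ᶠ P : ℝ in atTop, μ.real {ω | afDet β (P * E none ω) (fun l => P * E (some (l, true)) ω)
        (fun l => P * E (some (l, false)) ω) < 1 + T} ≤
      T ^ (n + 1) * ρ none * (∏ l, (ρ (some (l, true)) + ρ (some (l, false)))) /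
        ((n + 1).factorial * P ^ (n + 1)) := by
  -- Without relays no fresh symbol gives slack, but none is needed: there are no error terms.
  rcases Nat.eq_zero_or_pos n with rfl | hn
  · filter_upwards [eventually_gt_atTop 0] with P hP
    have h := measureReal_weak_hops_le hE hind hρ hlaw (fun _ => true) one_pos (div_pos hT hP)
    calc _ ≤ _ := measureReal_mono (fun ω hω => ?_)
      _ ≤ _ := h
      _ = _ := by simp; ring
    have h1 := (le_afDet (β := β) (u := P * E none ω) (S := fun l => P * E (some (l, true)) ω)
      (w := fun l => P * E (some (l, false)) ω) hβ (mul_nonneg hP.le (hE0 _ _))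
      (fun _ => mul_nonneg hP.le (hE0 _ _)) (fun _ => mul_nonneg hP.le (hE0 _ _))).1
    have h2 := h1.trans_lt hω
    simp only [Set.mem_ofPred_eq, Finset.univ_eq_empty, Finset.sum_empty] at h2 ⊢
    rw [lt_div_iff₀ hP]
    linarith
  set D : ℝ := ρ none * ∏ l, (ρ (some (l, true)) + ρ (some (l, false))) with hD
  set D₁ : ℝ := ∑ σ : Fin n → Bool, ρ none / directWeight σ * ∏ l, ρ (some (l, σ l)) with hD₁
  -- The strict gap comes from the pattern in which every weak hop leads to the destination; it
  -- needs at least one relay.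
  have hlt : D₁ < D := by
    rw [hD, ← sum_prod_bool fun l b => ρ (some (l, b)), Finset.mul_sum, hD₁]
    refine Finset.sum_lt_sum (fun σ _ => ?_) ⟨fun _ => true, Finset.mem_univ _, ?_⟩
    · exact mul_le_mul_of_nonneg_right (div_le_self (hρ none).le (one_le_directWeight σ))
        (Finset.prod_nonneg fun l _ => (hρ _).le)
    · refine mul_lt_mul_of_pos_right ?_ (Finset.prod_pos fun l _ => hρ _)
      rw [directWeight, if_pos ⟨⟨0, hn⟩, rfl⟩]
      linarith [hρ none]
  -- The gap absorbs the loss (1 - δ)^{-(n+1)} for small δ, and later, for large P, also the term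
  -- N/P.
  obtain ⟨δ, ⟨hδ, hδ1⟩, hδ2⟩ : ∃ δ : ℝ, (0 < δ ∧ δ < 1) ∧ D₁ / (1 - δ) ^ (n + 1) < D := by
    have hc : ContinuousAt (fun δ : ℝ => D₁ / (1 - δ) ^ (n + 1)) 0 :=
      ContinuousAt.div (by fun_prop) (by fun_prop) (by simp)
    have h1 : ∀ᶠ δ in 𝓝[>] (0 : ℝ), D₁ / (1 - δ) ^ (n + 1) < D :=
      (hc.eventually (Iio_mem_nhds (by simpa using hlt))).filter_mono nhdsWithin_le_nhds
    exact (Eventually.and (Ioo_mem_nhdsGT (zero_lt_one' ℝ)) h1).exists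
  obtain ⟨B, hB1, hB2⟩ : ∃ B : ℝ, 2 * T + 2 ≤ δ * B ∧ β * (2 * T + 1) ≤ B :=
    ⟨max ((2 * T + 2) / δ) (β * (2 * T + 1)), by
      rw [← div_le_iff₀' hδ]; exact le_max_left _ _, le_max_right _ _⟩
  have hB : 0 ≤ B := le_trans (by positivity) hB2
  obtain ⟨q, hq⟩ : ∃ q : ℝ, ∀ o, ρ o ≤ q :=
    ⟨∑ o, ρ o, fun o => Finset.single_le_sum (fun o _ => (hρ o).le) (Finset.mem_univ o)⟩
  set N : ℝ := ∑ _σ : Fin n → Bool, ∑ _l : Fin n, (q * B) ^ (n + 2) with hN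
  set k : ℝ := T ^ (n + 1) / (n + 1).factorial with hk
  have hkpos : 0 < k := by positivity
  have hbound : ∀ P : ℝ, 0 < P → μ.real {ω | afDet β (P * E none ω)
        (fun l => P * E (some (l, true)) ω) (fun l => P * E (some (l, false)) ω) < 1 + T} ≤
      (D₁ / (1 - δ) ^ (n + 1) * k + N / P) / P ^ (n + 1) := by
    intro P hP
    set F : (Fin n → Bool) → Set Ω := fun σ =>
      {ω | directWeight σ * E none ω + ∑ l, E (some (l, σ l)) ω < T / ((1 - δ) * P)} with hF
    set W : (Fin n → Bool) → Fin n → Set Ω := fun σ l =>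
      {ω | E none ω < B / P ∧ (∀ m, E (some (m, σ m)) ω < B / P) ∧ E (some (l, !σ l)) ω < B / P}
      with hW
    have hd : 0 < (1 - δ) * P := mul_pos (by linarith) hP
    calc _ ≤ μ.real (⋃ σ, (F σ ∪ ⋃ l, W σ l)) := measureReal_mono (fun ω hω => ?_)
      _ ≤ ∑ σ, (μ.real (F σ) + ∑ l, μ.real (W σ l)) :=
          (measureReal_iUnion_fintype_le _).trans (Finset.sum_le_sum fun σ _ =>
            (measureReal_union_le _ _).trans (add_le_add le_rfl (measureReal_iUnion_fintype_le _)))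
      _ ≤ ∑ σ, (ρ none / directWeight σ * (∏ l, ρ (some (l, σ l))) * (T / ((1 - δ) * P)) ^ (n + 1)
            / (n + 1).factorial + ∑ _l : Fin n, (q * (B / P)) ^ (n + 2)) := by
          gcongr with σ _ l _
          · exact measureReal_weak_hops_le hE hind hρ hlaw σ
              (zero_lt_one.trans_le (one_le_directWeight σ)) (div_pos hT hd)
          · exact measureReal_both_hops_weak_le hE hind hρ hlaw σ l hq (div_nonneg hB hP.le)
      _ = (D₁ / (1 - δ) ^ (n + 1) * k + N / P) / P ^ (n + 1) := by
          rw [Finset.sum_add_distrib, ← Finset.sum_div, ← Finset.sum_mul, ← hD₁]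
          simp only [hN, hk, Finset.sum_const, nsmul_eq_mul, ← mul_div_assoc q B P, div_pow, mul_pow]
          have : (1 - δ) ≠ 0 := by linarith
          field_simp
          ring
    obtain ⟨σ, hσ⟩ := exists_weak_hops_of_afDet_lt (G := fun o => P * E o ω) hβ hT hδ hδ1 hB1 hB2
      (fun o => mul_nonneg hP.le (hE0 _ _)) hω
    refine Set.mem_iUnion.2 ⟨σ, ?_⟩
    rcases hσ with hσ | ⟨l, h1, h2, h3⟩
    · left
      simp only [hF, Set.mem_ofPred_eq]
      rw [lt_div_iff₀ hd]
      rw [← Finset.mul_sum] at hσ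
      linarith
    · right
      refine Set.mem_iUnion.2 ⟨l, ?_, fun m => ?_, ?_⟩
      · rw [lt_div_iff₀' hP]; exact h1
      · rw [lt_div_iff₀' hP]; exact h2 m
      · rw [lt_div_iff₀' hP]; exact h3
  have hlim : Tendsto (fun P : ℝ => D₁ / (1 - δ) ^ (n + 1) * k + N / P) atTop
      (𝓝 (D₁ / (1 - δ) ^ (n + 1) * k + 0)) :=
    tendsto_const_nhds.add (tendsto_const_nhds.div_atTop tendsto_id)
  rw [add_zero] at hlim
  filter_upwards [eventually_gt_atTop 0,
    hlim.eventually (Iio_mem_nhds (mul_lt_mul_of_pos_right hδ2 hkpos))] with P hP hlt'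
  refine (hbound P hP).trans ?_
  have hlt'' : D₁ / (1 - δ) ^ (n + 1) * k + N / P ≤ D * k := le_of_lt hlt'
  calc _ ≤ D * k / P ^ (n + 1) := by gcongr
    _ = _ := by simp only [hk, hD]; field_simp

end Outage

/-! ### Small-threshold asymptotics and diversity order -/

/-- The lower densities ρ e^{-ρt} multiply to a factor exp(-t ∑ ρ) ≥ 1 - t ∑ ρ, the source of the
O(P^{-L-1}) error. -/
theorem measureReal_sum_exponential_lt_bounds {Ω : Type*} [MeasurableSpace Ω] {μ : Measure Ω}
    [IsProbabilityMeasure μ] {ι : Type*} [Fintype ι] {X : ι → Ω → ℝ}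
    (hX : ∀ i, AEMeasurable (X i) μ) (hind : iIndepFun X μ) {ρ : ι → ℝ} (hρ : ∀ i, 0 < ρ i)
    (hlaw : ∀ i, μ.map (X i) = (volume.restrict (Set.Ioi 0)).withDensity fun x =>
        ENNReal.ofReal (ρ i * Real.exp (-(ρ i * x)))) {t : ℝ} (ht : 0 < t) :
    (∏ i, ρ i) * (1 - t * ∑ i, ρ i) * t ^ Fintype.card ι / (Fintype.card ι).factorial ≤
        μ.real {ω | ∑ i, X i ω < t} ∧
      μ.real {ω | ∑ i, X i ω < t} ≤
        (∏ i, ρ i) * t ^ Fintype.card ι / (Fintype.card ι).factorial := by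
  have hC : 0 ≤ ∏ i, ρ i := Finset.prod_nonneg fun i _ => (hρ i).le
  constructor
  · have h := le_measure_sum_lt hX hind (r := fun i => ρ i * Real.exp (-(ρ i * t)))
      (fun i => mul_nonneg (hρ i).le (Real.exp_nonneg _)) (t₀ := t)
      (fun i => by rw [hlaw]; exact le_exponential (hρ i).le t) Finset.univ le_rfl
    rw [simplexVol, if_pos ht, Finset.card_univ] at h
    have h' := (ENNReal.ofReal_le_iff_le_toReal (measure_ne_top _ _)).1 h
    refine le_trans ?_ h'
    rw [Finset.prod_mul_distrib, ← Real.exp_sum, Finset.sum_neg_distrib, ← Finset.sum_mul]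
    gcongr
    have := Real.add_one_le_exp (-((∑ i, ρ i) * t))
    linarith
  · have h := measure_sum_lt_le hX hind (r := ρ) (fun i => (hρ i).le)
      (fun i => by rw [hlaw]; exact exponential_le (hρ i).le) Finset.univ t
    rw [simplexVol, if_pos ht, Finset.card_univ] at h
    exact ENNReal.toReal_le_of_le_ofReal (by positivity) h

theorem hasDiversityOrder_of_bounds {p : ℝ → ℝ} {m : ℕ} {c C : ℝ} (hc : 0 < c)
    (h1 : ∀ᶠ P : ℝ in atTop, c / P ^ m ≤ p P) (h2 : ∀ᶠ P : ℝ in atTop, p P ≤ C / P ^ m) :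
    HasDiversityOrder p m := by
  have hlim : ∀ a : ℝ, Tendsto (fun P : ℝ => (m : ℝ) - Real.log a / Real.log P) atTop (𝓝 m) := by
    intro a
    simpa using (tendsto_const_nhds (x := (m : ℝ))).sub
      ((tendsto_const_nhds (x := Real.log a)).div_atTop Real.tendsto_log_atTop)
  refine tendsto_of_tendsto_of_tendsto_of_le_of_le' (hlim C) (hlim c) ?_ ?_
  · filter_upwards [h1, h2, eventually_gt_atTop 1] with P h1 h2 hP
    have hP0 : 0 < P := by linarith
    have hlog := Real.log_pos hP
    have hpos : 0 < p P := (by positivity : 0 < c / P ^ m).trans_le h1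
    -- Positivity of `C` is forced by the lower bound.
    have hC : 0 < C := by
      have := hpos.trans_le h2
      rwa [div_pos_iff_of_pos_right (by positivity)] at this
    have := Real.log_le_log hpos h2
    rw [Real.log_div hC.ne' (by positivity), Real.log_pow] at this
    rw [le_div_iff₀ hlog, sub_mul, div_mul_cancel₀ _ hlog.ne']
    linarith
  · filter_upwards [h1, eventually_gt_atTop 1] with P h1 hP
    have hP0 : 0 < P := by linarith
    have hlog := Real.log_pos hP
    have := Real.log_le_log (by positivity) h1
    rw [Real.log_div hc.ne' (by positivity), Real.log_pow] at this
    rw [div_le_iff₀ hlog, sub_mul, div_mul_cancel₀ _ hlog.ne']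
    linarith

/-! ### Outage events in terms of independent link gains -/

theorem norm_fadingGain_sq {K : ℕ} {d : Option (Fin K) → Fin K → ℝ} (γ : ℝ)
    (a : Option (Fin K) → Fin K → ℂ) {m : Option (Fin K)} {j : Fin K} (h : 0 < d m j) :
    ‖fadingGain d γ a m j‖ ^ 2 = ‖a m j‖ ^ 2 / d m j ^ γ := by
  rw [fadingGain, norm_div, div_pow, Complex.norm_real, Real.norm_eq_abs, sq_abs,
    ← Real.rpow_natCast (d m j ^ (γ / 2)), ← Real.rpow_mul h.le]
  congr 2
  push_cast; ring

/-- The mean received power of a link per unit of `P`: transmissions to the destination are made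
with power `lam j * P`, those to another user with power `P`. -/
noncomputable def meanGain {K : ℕ} (d : Option (Fin K) → Fin K → ℝ) (γ : ℝ) (lam : Fin K → ℝ)
    (p : Link K) : ℝ :=
  (if p.1.1 = none then lam p.1.2 else 1) / d p.1.1 p.1.2 ^ γ

/-- The links used by the scheme: `none` is the direct link, `some (l, true)` leads from the relay
of slot `l.succ` to the destination and `some (l, false)` from the source to that relay. -/
def schemeLink {K n : ℕ} (π : Fin (n + 1) → Fin K) (hπ : Function.Injective π) :
    Option (Fin n × Bool) → Link K
  | none => ⟨(none, π 0), by simp⟩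
  | some (l, true) => ⟨(none, π l.succ), by simp⟩
  | some (l, false) => ⟨(some (π l.succ), π 0), fun h =>
      Fin.succ_ne_zero l (hπ (Option.some_injective _ h))⟩

/-- Distinct links make the `2 * n + 1` gains used by the scheme independent. -/
theorem schemeLink_injective {K n : ℕ} (π : Fin (n + 1) → Fin K) (hπ : Function.Injective π) :
    Function.Injective (schemeLink π hπ) := by
  rintro (_ | ⟨l, _ | _⟩) (_ | ⟨l', _ | _⟩) h <;>
    simp [schemeLink, hπ.eq_iff, (Fin.succ_ne_zero _).symm] at h ⊢
  · exact h
  · exact h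

section Network

variable {Ω : Type*} [MeasurableSpace Ω] {μ : Measure Ω} {K n : ℕ}
  {A : Option (Fin K) → Fin K → Ω → ℂ} {d : Option (Fin K) → Fin K → ℝ} {γ : ℝ}
  {lam : Fin K → ℝ}

theorem meanGain_pos (hd : ∀ p : Link K, 0 < d p.1.1 p.1.2) (hlam : ∀ j, 0 < lam j) (p : Link K) :
    0 < meanGain d γ lam p := by
  have := Real.rpow_pos_of_pos (hd p) γ
  have := hlam p.1.2
  unfold meanGain
  split_ifs <;> positivity

theorem iIndepFun_linkGain {ι : Type*} (hind : iIndepFun (fun (p : Link K) => A p.1.1 p.1.2) μ)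
    {e : ι → Link K} (he : Function.Injective e) :
    iIndepFun (fun i ω => meanGain d γ lam (e i) * ‖A (e i).1.1 (e i).1.2 ω‖ ^ 2) μ :=
  (hind.precomp he).comp (fun i z => meanGain d γ lam (e i) * ‖z‖ ^ 2) fun i => by fun_prop

theorem aemeasurable_linkGain (hA : ∀ p : Link K, HasLaw (A p.1.1 p.1.2) stdComplexGaussian μ)
    (p : Link K) : AEMeasurable (fun ω => meanGain d γ lam p * ‖A p.1.1 p.1.2 ω‖ ^ 2) μ :=
  ((hA p).aemeasurable.norm.pow_const 2).const_mul _

theorem afOutage_eq (hd : ∀ p : Link K, 0 < d p.1.1 p.1.2) (hlam : ∀ j, 0 < lam j)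
    {π : Fin (n + 1) → Fin K} (hπ : Function.Injective π) (hlam0 : lam (π 0) = 1) {β : ℝ}
    (hβ : 1 ≤ β) (R : ℝ) {P : ℝ} (hP : 0 < P) :
    let E := fun (o : Option (Fin n × Bool)) ω => meanGain d γ lam (schemeLink π hπ o) *
      ‖A (schemeLink π hπ o).1.1 (schemeLink π hπ o).1.2 ω‖ ^ 2
    afOutage μ A d γ π β lam R P =
      μ.real {ω | afDet β (P * E none ω) (fun l => P * E (some (l, true)) ω)
        (fun l => P * E (some (l, false)) ω) < (2 : ℝ) ^ (((n + 1 : ℕ) : ℝ) * R)} := by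
  intro E
  unfold afOutage
  congr 1
  ext ω
  have hE0 : ∀ o, 0 ≤ P * E o ω := fun o => by
    have := meanGain_pos (γ := γ) hd hlam (schemeLink π hπ o)
    simp only [E]; positivity
  have hpos : 0 < afDet β (P * E none ω) (fun l => P * E (some (l, true)) ω)
        (fun l => P * E (some (l, false)) ω) := by
    refine lt_of_lt_of_le ?_ (le_afDet hβ (hE0 _) (fun _ => hE0 _) (fun _ => hE0 _)).1
    have := hE0 none
    have h2 : 0 ≤ ∑ l, P * E (some (l, true)) ω * (P * E (some (l, false)) ω) /
        (1 + P * E (some (l, true)) ω + P * E (some (l, false)) ω) :=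
      Finset.sum_nonneg fun l _ => by
        have := hE0 (some (l, true)); have := hE0 (some (l, false)); positivity
    linarith
  have h0 : P * ‖fadingGain d γ (fun m j => A m j ω) none (π 0)‖ ^ 2 = P * E none ω := by
    rw [norm_fadingGain_sq _ _ (show 0 < d none (π 0) from hd (schemeLink π hπ none))]
    simp only [E, meanGain, schemeLink, if_true, hlam0]
    ring
  have h1 : ∀ l : Fin n, P * (lam (π l.succ) *
      ‖fadingGain d γ (fun m j => A m j ω) none (π l.succ)‖ ^ 2) = P * E (some (l, true)) ω := by
    intro l
    rw [norm_fadingGain_sq _ _ (show 0 < d none (π l.succ) from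
      hd (schemeLink π hπ (some (l, true))))]
    simp only [E, meanGain, schemeLink, if_true]
    ring
  have h2 : ∀ l : Fin n, P * ‖fadingGain d γ (fun m j => A m j ω) (some (π l.succ)) (π 0)‖ ^ 2 =
      P * E (some (l, false)) ω := by
    intro l
    rw [norm_fadingGain_sq _ _ (show 0 < d (some (π l.succ)) (π 0) from
      hd (schemeLink π hπ (some (l, false))))]
    simp only [E, meanGain, schemeLink, reduceCtorEq, if_false]
    ring
  simp only [Set.mem_ofPred_eq]
  rw [det_afMatrix π _ (zero_le_one.trans hβ) lam hlam hlam0 hP]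
  simp only [h0, h1, h2]
  exact Real.logb_lt_iff_lt_rpow one_lt_two hpos

theorem mimoOutage_eq (hd : ∀ p : Link K, 0 < d p.1.1 p.1.2) (hlam : ∀ j, 0 < lam j)
    (π : Fin (n + 1) → Fin K) (R : ℝ) {P : ℝ} (hP : 0 < P) :
    mimoOutage μ A d γ π lam R P =
      μ.real {ω | ∑ l, meanGain d γ lam ⟨(none, π l), by simp⟩ * ‖A none (π l) ω‖ ^ 2 <
        ((2 : ℝ) ^ R - 1) / P} := by
  unfold mimoOutage
  congr 1
  ext ω
  have h1 : ∀ l, lam (π l) * P * ‖fadingGain d γ (fun m j => A m j ω) none (π l)‖ ^ 2 =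
      P * (meanGain d γ lam ⟨(none, π l), by simp⟩ * ‖A none (π l) ω‖ ^ 2) := by
    intro l
    rw [norm_fadingGain_sq _ _ (hd ⟨(none, π l), by simp⟩)]
    simp only [meanGain, if_true]
    ring
  simp only [Set.mem_ofPred_eq, h1, ← Finset.mul_sum]
  have hnn : 0 ≤ P * ∑ l, meanGain d γ lam ⟨(none, π l), by simp⟩ * ‖A none (π l) ω‖ ^ 2 :=
    mul_nonneg hP.le (Finset.sum_nonneg fun l _ =>
      mul_nonneg (meanGain_pos hd hlam _).le (by positivity))
  rw [Real.logb_lt_iff_lt_rpow one_lt_two (by linarith), lt_div_iff₀' hP, lt_sub_iff_add_lt']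

theorem mimoOutage_bounds [IsProbabilityMeasure μ]
    (hd : ∀ p : Link K, 0 < d p.1.1 p.1.2)
    (hA : ∀ p : Link K, HasLaw (A p.1.1 p.1.2) stdComplexGaussian μ)
    (hind : iIndepFun (fun (p : Link K) => A p.1.1 p.1.2) μ) (hlam : ∀ j, 0 < lam j)
    {π : Fin (n + 1) → Fin K} (hπ : Function.Injective π) {R : ℝ} (hR : 0 < R) {P : ℝ}
    (hP : 0 < P) :
    (∏ l, d none (π l) ^ γ / lam (π l)) *
        (1 - ((2 : ℝ) ^ R - 1) / P * ∑ l, d none (π l) ^ γ / lam (π l)) *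
        (((2 : ℝ) ^ R - 1) / P) ^ (n + 1) / (n + 1).factorial ≤ mimoOutage μ A d γ π lam R P ∧
      mimoOutage μ A d γ π lam R P ≤
        (∏ l, d none (π l) ^ γ / lam (π l)) * (((2 : ℝ) ^ R - 1) / P) ^ (n + 1) /
          (n + 1).factorial := by
  set e : Fin (n + 1) → Link K := fun l => ⟨(none, π l), by simp⟩ with he
  have hinj : Function.Injective e := fun l m h => hπ (by simpa [he] using h)
  have ht : 0 < ((2 : ℝ) ^ R - 1) / P :=
    div_pos (sub_pos.2 (Real.one_lt_rpow one_lt_two hR)) hP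
  have hinv : ∀ l, (meanGain d γ lam (e l))⁻¹ = d none (π l) ^ γ / lam (π l) := fun l => by
    simp [meanGain, he]
  have h := measureReal_sum_exponential_lt_bounds
    (fun l => aemeasurable_linkGain (d := d) (γ := γ) (lam := lam) hA (e l))
    (iIndepFun_linkGain hind hinj) (fun l => inv_pos.2 (meanGain_pos hd hlam (e l)))
    (fun l => map_mul_norm_sq_of_hasLaw (hA (e l)) (meanGain_pos hd hlam (e l))) ht
  rw [mimoOutage_eq hd hlam π R hP]
  simpa only [hinv, Fintype.card_fin] using h

theorem mimoOutage_le_afOutage [IsProbabilityMeasure μ]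
    (hd : ∀ p : Link K, 0 < d p.1.1 p.1.2) (hlam : ∀ j, 0 < lam j)
    {π : Fin (n + 1) → Fin K} (hπ : Function.Injective π) (hlam0 : lam (π 0) = 1) {β : ℝ}
    (hβ1 : 1 ≤ β) (hβ2 : β ≤ max 2 ((n + 1 : ℕ) : ℝ)) (R : ℝ) {P : ℝ} (hP : 0 < P) :
    mimoOutage μ A d γ π lam R P ≤ afOutage μ A d γ π β lam R P := by
  rw [afOutage_eq hd hlam hπ hlam0 hβ1 R hP, mimoOutage_eq hd hlam π R hP]
  refine measureReal_mono fun ω hω => ?_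
  simp only [Set.mem_ofPred_eq] at hω ⊢
  have hE0 : ∀ p : Link K, 0 ≤ P * (meanGain d γ lam p * ‖A p.1.1 p.1.2 ω‖ ^ 2) := fun p =>
    mul_nonneg hP.le (mul_nonneg (meanGain_pos hd hlam p).le (by positivity))
  refine (afDet_le (zero_le_one.trans hβ1) hβ2 (hE0 _) (fun _ => hE0 _) fun _ => hE0 _).trans_lt ?_
  rw [lt_div_iff₀' hP, Fin.sum_univ_succ, mul_add, Finset.mul_sum, lt_sub_iff_add_lt',
    ← add_assoc] at hω
  -- 2^{LR} = (2^R)^L matches the power in `afDet_le`.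
  rw [mul_comm ((n + 1 : ℕ) : ℝ) R, Real.rpow_mul zero_le_two, Real.rpow_natCast]
  refine pow_lt_pow_left₀ hω ?_ (Nat.succ_ne_zero n)
  have h1 := hE0 (schemeLink π hπ none)
  have h2 := Finset.sum_nonneg fun l (_ : l ∈ Finset.univ) =>
    hE0 (schemeLink π hπ (some (l, true)))
  exact add_nonneg (add_nonneg zero_le_one h1) h2

end Network

/-! ### The main theorem -/

theorem mainTheorem5
    {Ω : Type*} [MeasurableSpace Ω] (μ : Measure Ω) [IsProbabilityMeasure μ]
    (K n : ℕ) (π : Fin (n + 1) → Fin K) (hπ : Function.Injective π)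
    (d : Option (Fin K) → Fin K → ℝ) (hd : ∀ p : Link K, 0 < d p.1.1 p.1.2)
    (γ : ℝ)
    (A : Option (Fin K) → Fin K → Ω → ℂ)
    (hA : ∀ p : Link K, HasLaw (A p.1.1 p.1.2) stdComplexGaussian μ)
    (hind : iIndepFun (fun (p : Link K) => A p.1.1 p.1.2) μ)
    (lam : Fin K → ℝ) (hlam : ∀ j, 0 < lam j) (hlam0 : lam (π 0) = 1)
    (β : ℝ) (hβ1 : 1 ≤ β) (hβ2 : β ≤ max 2 ((n + 1 : ℕ) : ℝ))
    (R : ℝ) (hR : 0 < R) :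
    (∀ P : ℝ, 0 < P → mimoOutage μ A d γ π lam R P ≤ afOutage μ A d γ π β lam R P) ∧
    ((fun P : ℝ => mimoOutage μ A d γ π lam R P
        - ((2 : ℝ) ^ R - 1) ^ (n + 1) * (∏ l : Fin (n + 1), (d none (π l)) ^ γ / lam (π l))
          / ((Nat.factorial (n + 1) : ℝ) * P ^ (n + 1)))
      =O[atTop] (fun P : ℝ => (P ^ (n + 2))⁻¹)) ∧
    (∀ᶠ P : ℝ in atTop, afOutage μ A d γ π β lam R P ≤
      ((2 : ℝ) ^ (((n + 1 : ℕ) : ℝ) * R) - 1) ^ (n + 1) * (d none (π 0)) ^ γ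
        * (∏ l : Fin n, ((d none (π l.succ)) ^ γ / lam (π l.succ)
            + (d (some (π l.succ)) (π 0)) ^ γ))
        / ((Nat.factorial (n + 1) : ℝ) * P ^ (n + 1))) ∧
    HasDiversityOrder (afOutage μ A d γ π β lam R) ((n + 1 : ℕ) : ℝ) := by
  have hle : ∀ P : ℝ, 0 < P → mimoOutage μ A d γ π lam R P ≤ afOutage μ A d γ π β lam R P :=
    fun P hP => mimoOutage_le_afOutage hd hlam hπ hlam0 hβ1 hβ2 R hP
  set s : ℝ := (2 : ℝ) ^ R - 1 with hs
  have hs0 : 0 < s := sub_pos.2 (Real.one_lt_rpow one_lt_two hR)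
  set C : ℝ := ∏ l, d none (π l) ^ γ / lam (π l) with hC
  set S : ℝ := ∑ l, d none (π l) ^ γ / lam (π l) with hS
  have hrate : ∀ l, 0 < d none (π l) ^ γ / lam (π l) := fun l =>
    div_pos (Real.rpow_pos_of_pos (hd ⟨(none, π l), by simp⟩) γ) (hlam _)
  have hC0 : 0 < C := Finset.prod_pos fun l _ => hrate l
  have hbounds := fun {P : ℝ} (hP : 0 < P) =>
    mimoOutage_bounds (γ := γ) hd hA hind hlam hπ hR hP
  have hupper : ∀ᶠ P : ℝ in atTop, afOutage μ A d γ π β lam R P ≤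
      ((2 : ℝ) ^ (((n + 1 : ℕ) : ℝ) * R) - 1) ^ (n + 1) * (d none (π 0)) ^ γ
        * (∏ l : Fin n, ((d none (π l.succ)) ^ γ / lam (π l.succ)
            + (d (some (π l.succ)) (π 0)) ^ γ))
        / ((Nat.factorial (n + 1) : ℝ) * P ^ (n + 1)) := by
    have hT : 0 < (2 : ℝ) ^ (((n + 1 : ℕ) : ℝ) * R) - 1 :=
      sub_pos.2 (Real.one_lt_rpow one_lt_two (by positivity))
    have hgain := fun p : Link K => meanGain_pos (γ := γ) hd hlam p
    have h := eventually_measureReal_afDet_lt_le (μ := μ) (n := n) (β := β)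
      (fun o => aemeasurable_linkGain (d := d) (γ := γ) (lam := lam) hA (schemeLink π hπ o))
      (fun o ω => mul_nonneg (hgain _).le (by positivity))
      (iIndepFun_linkGain hind (schemeLink_injective π hπ)) (fun o => inv_pos.2 (hgain _))
      (fun o => by
        rw [map_mul_norm_sq_of_hasLaw (hA (schemeLink π hπ o)) (hgain _)]
        exact exponential_le (inv_pos.2 (hgain _)).le) hβ1 hT
    filter_upwards [h, eventually_gt_atTop 0] with P h hP
    rw [afOutage_eq hd hlam hπ hlam0 hβ1 R hP]
    rw [add_sub_cancel] at h
    refine h.trans_eq ?_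
    simp [meanGain, schemeLink, hlam0]
  refine ⟨hle, ?_, hupper, ?_⟩
  · refine IsBigO.of_bound (C * S * s ^ (n + 2) / (n + 1).factorial) ?_
    filter_upwards [eventually_gt_atTop 0] with P hP
    obtain ⟨h1, h2⟩ := hbounds hP
    have hfac : (0 : ℝ) < (n + 1).factorial := by positivity
    have e1 : C * (s / P) ^ (n + 1) / (n + 1).factorial =
        s ^ (n + 1) * C / ((n + 1).factorial * P ^ (n + 1)) := by
      rw [div_pow]; field_simp
    have e2 : C * (1 - s / P * S) * (s / P) ^ (n + 1) / (n + 1).factorial =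
        s ^ (n + 1) * C / ((n + 1).factorial * P ^ (n + 1)) -
          C * S * s ^ (n + 2) / (n + 1).factorial * (P ^ (n + 2))⁻¹ := by
      rw [div_pow]; field_simp; ring
    rw [e2] at h1
    rw [e1] at h2
    have hS0 : 0 ≤ S := Finset.sum_nonneg fun l _ => (hrate l).le
    have hnn : 0 ≤ C * S * s ^ (n + 2) / (n + 1).factorial * (P ^ (n + 2))⁻¹ := by positivity
    rw [Real.norm_of_nonneg (by positivity : 0 ≤ (P ^ (n + 2))⁻¹), Real.norm_eq_abs, abs_le]
    constructor <;> linarith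
  -- The factor 1/2 bounds from below the correction 1 - sS/P, which tends to 1.
  · refine hasDiversityOrder_of_bounds (c := C * (1 / 2) * s ^ (n + 1) / (n + 1).factorial)
      (by positivity) ?_ (hupper.mono fun P h => h.trans_eq (by rw [div_mul_eq_div_div]))
    have hlim : Tendsto (fun P : ℝ => 1 - s / P * S) atTop (𝓝 (1 - 0 * S)) :=
      tendsto_const_nhds.sub ((tendsto_const_nhds.div_atTop tendsto_id).mul_const S)
    filter_upwards [eventually_gt_atTop 0,
      hlim.eventually (Ioi_mem_nhds (by norm_num : (1 / 2 : ℝ) < 1 - 0 * S))] with P hP hhalf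
    refine le_trans ?_ ((hbounds hP).1.trans (hle P hP))
    have hhalf' : 1 / 2 ≤ 1 - s / P * S := le_of_lt hhalf
    calc C * (1 / 2) * s ^ (n + 1) / (n + 1).factorial / P ^ (n + 1)
        = C * (1 / 2) * (s / P) ^ (n + 1) / (n + 1).factorial := by rw [div_pow]; field_simp
      _ ≤ _ := by gcongr
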